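/- Let $G$ be a torsion nilpotent group (of arbitrary nilpotency class) and let $\phi\colon G\to G$ be a group endomorphism. For a finite subgroup $F\le G$ and $n\ge 1$ put $$T_n(\phi,F)=F\,\phi(F)\,\phi^2(F)\cdots\phi^{n-1}(F)\subseteq G$$ (a product of subsets of $G$), let $$H(\phi,F)=\lim_{n\to\infty}\frac1n\log|T_n(\phi,F)|,$$ where the limit exists by subadditivity, and let $$h(\phi)=\sup\{H(\phi,F) : F\le G \text{ a finite subgroup}\}\in[0,\infty]$$ be the algebraic entropy of $\phi$. If $h(\phi)<\infty$, then $h(\phi)=\log(\alpha)$ for some positive integer $\alpha$. -/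

import Mathlib

open Filter Topology
open scoped Pointwise

namespace AlgebraicEntropy

/-- The `n`-th trajectory `T_n(φ, F) = F · φ(F) ⋯ φ^{n-1}(F)` of a subgroup `F` of `G`, a product of
subsets of `G` (it need not be a subgroup). For `n = 0` it is the empty product `{1}`. -/
def trajectory {G : Type*} [Group G] (φ : G →* G) (F : Subgroup G) : ℕ → Set G
  | 0 => 1
  | n + 1 => trajectory φ F n * (φ^[n] '' (F : Set G))

/-- The entropy `H(φ, F) = lim (1/n) log |T_n(φ, F)|` of `φ` with respect to a finite subgroup `F`.
The limit exists, see `tendsto_entropyOn`. -/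
noncomputable def entropyOn {G : Type*} [Group G] (φ : G →* G) (F : Subgroup G) : ℝ :=
  limUnder atTop fun n : ℕ => Real.log ((trajectory φ F n).ncard : ℝ) / (n : ℝ)

/-- The algebraic entropy `h(φ) ∈ [0, ∞]` of an endomorphism of a locally finite group `G`: the
supremum of `H(φ, F)` over all finite subgroups `F` of `G`. -/
noncomputable def entropy {G : Type*} [Group G] (φ : G →* G) : EReal :=
  ⨆ F : {F : Subgroup G // (F : Set G).Finite}, (entropyOn φ F.1 : EReal)

theorem trajectory_finite {G : Type*} [Group G] (φ : G →* G) (F : Subgroup G)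
    (hF : (F : Set G).Finite) (n : ℕ) : (trajectory φ F n).Finite := by
  induction n with
  | zero => exact Set.finite_one
  | succ n ih => exact ih.mul (hF.image _)

theorem one_mem_trajectory {G : Type*} [Group G] (φ : G →* G) (F : Subgroup G) (n : ℕ) :
    (1 : G) ∈ trajectory φ F n := by
  induction n with
  | zero => exact Set.mem_one.2 rfl
  | succ n ih =>
    exact Set.mem_mul.2 ⟨1, ih, 1, ⟨1, F.one_mem, iterate_map_one φ n⟩, mul_one 1⟩

theorem trajectory_add {G : Type*} [Group G] (φ : G →* G) (F : Subgroup G) (m n : ℕ) :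
    trajectory φ F (m + n) = trajectory φ F m * (φ^[m] '' trajectory φ F n) := by
  induction n with
  | zero => simp [trajectory]
  | succ n ih =>
    have h : (φ^[m] '' (trajectory φ F n * (φ^[n] '' (F : Set G))))
        = (φ^[m] '' trajectory φ F n) * (φ^[m + n] '' (F : Set G)) := by
      have e : ∃ ψ : G →* G, ⇑ψ = φ^[m] :=
        ⟨((id φ : Monoid.End G) ^ m : Monoid.End G), Monoid.End.coe_pow G φ m⟩
      obtain ⟨ψ, hψ⟩ := e
      rw [Function.iterate_add, Set.image_comp, ← hψ, Set.image_mul]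
    rw [← add_assoc, trajectory, ih, trajectory, h, mul_assoc]

theorem subadditive_log_trajectory {G : Type*} [Group G] (φ : G →* G) (F : Subgroup G)
    (hF : (F : Set G).Finite) :
    Subadditive fun n : ℕ => Real.log ((trajectory φ F n).ncard : ℝ) := by
  intro m n
  have pos : ∀ k, 0 < (trajectory φ F k).ncard := fun k =>
    (Set.ncard_pos (trajectory_finite φ F hF k)).2 ⟨1, one_mem_trajectory φ F k⟩
  have le : (trajectory φ F (m + n)).ncard
      ≤ (trajectory φ F m).ncard * (trajectory φ F n).ncard := by
    rw [trajectory_add, ← Nat.card_coe_set_eq, ← Nat.card_coe_set_eq (trajectory φ F m)]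
    refine (Set.natCard_mul_le).trans (Nat.mul_le_mul_left _ ?_)
    rw [Nat.card_coe_set_eq]
    exact Set.ncard_image_le (trajectory_finite φ F hF n)
  have hm := pos m
  have hn := pos n
  have hmn := pos (m + n)
  change Real.log _ ≤ Real.log _ + Real.log _
  rw [← Real.log_mul (by positivity) (by positivity)]
  exact Real.log_le_log (by positivity) (by exact_mod_cast le)

/-- The limit in the definition of `entropyOn` exists for every finite subgroup `F`. -/
theorem tendsto_entropyOn {G : Type*} [Group G] (φ : G →* G) (F : Subgroup G)
    (hF : (F : Set G).Finite) :
    Tendsto (fun n : ℕ => Real.log ((trajectory φ F n).ncard : ℝ) / (n : ℝ)) atTop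
      (𝓝 (entropyOn φ F)) := by
  refine tendsto_nhds_limUnder ⟨_, (subadditive_log_trajectory φ F hF).tendsto_lim ⟨0, ?_⟩⟩
  rintro _ ⟨n, rfl⟩
  exact div_nonneg (Real.log_natCast_nonneg _) (Nat.cast_nonneg _)

end AlgebraicEntropy

/-! For abelian `G` trajectories are subgroups, and `|T_{n+1}|/|T_n|` is the index in `F` of the
elements that `φ^n` sends into `T_n`. These form an increasing chain in a finite group, so the index
is eventually a constant integer and `H(φ, F)` is its logarithm; bounded integers attain their
maximum.

Trajectories are not subgroups in general, so the induction on nilpotency class carries a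
set-theoretic substitute, `HasCarry`: rewriting `φ^k(E) φ(S)` as `S C` with `|C| ≤ a` works like
carrying in base `a` and bounds every `H(φ, F)` by `log a`. Along a central extension carry bounds
multiply (`HasCarry.extension`) while entropies are superadditive (`entropyOn_add_le`). Hence the
upper bound `log (a * b)` is attained. -/

namespace AlgebraicEntropy

/-! ### Growth of trajectories and carries -/

section Growth

variable {G : Type*} [Group G] (φ : G →* G) (F : Subgroup G)

theorem trajectory_ncard_pos (hF : (F : Set G).Finite) (n : ℕ) :
    0 < (trajectory φ F n).ncard :=
  (Set.ncard_pos (trajectory_finite φ F hF n)).2 ⟨1, one_mem_trajectory φ F n⟩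

theorem ncard_mul_le {s t : Set G} : (s * t).ncard ≤ s.ncard * t.ncard := by
  simpa only [Nat.card_coe_set_eq] using Set.natCard_mul_le (s := s) (t := t)

theorem entropyOn_nonneg (hF : (F : Set G).Finite) : 0 ≤ entropyOn φ F :=
  ge_of_tendsto' (tendsto_entropyOn φ F hF) fun _ =>
    div_nonneg (Real.log_natCast_nonneg _) (Nat.cast_nonneg _)

theorem tendsto_log_mul_pow_div (c : ℕ) (hc : 0 < c) (M : ℝ) (hM : 0 < M) :
    Tendsto (fun n : ℕ => Real.log (M * (c : ℝ) ^ n) / n) atTop (𝓝 (Real.log c)) := by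
  have h := (tendsto_const_div_atTop_nhds_zero_nat (Real.log M)).add_const (Real.log c)
  rw [zero_add] at h
  refine h.congr' ?_
  filter_upwards [eventually_gt_atTop 0] with n hn
  have hn' : (n : ℝ) ≠ 0 := by positivity
  have hc' : (c : ℝ) ≠ 0 := by positivity
  rw [Real.log_mul hM.ne' (pow_ne_zero _ hc'), Real.log_pow]
  field_simp

theorem entropyOn_le_log (hF : (F : Set G).Finite) {c : ℕ} (hc : 0 < c) {M : ℝ} (hM : 0 < M)
    (h : ∀ᶠ n in atTop, ((trajectory φ F n).ncard : ℝ) ≤ M * (c : ℝ) ^ n) :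
    entropyOn φ F ≤ Real.log c := by
  refine le_of_tendsto_of_tendsto (tendsto_entropyOn φ F hF)
    (tendsto_log_mul_pow_div c hc M hM) ?_
  filter_upwards [h] with n hn
  have := trajectory_ncard_pos φ F hF n
  gcongr

theorem log_le_entropyOn (hF : (F : Set G).Finite) {c : ℕ} (hc : 0 < c) {M : ℝ} (hM : 0 < M)
    (h : ∀ᶠ n in atTop, M * (c : ℝ) ^ n ≤ ((trajectory φ F n).ncard : ℝ)) :
    Real.log c ≤ entropyOn φ F := by
  refine le_of_tendsto_of_tendsto (tendsto_log_mul_pow_div c hc M hM)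
    (tendsto_entropyOn φ F hF) ?_
  filter_upwards [h] with n hn
  gcongr

/-- The trajectories of every finite set can be rewritten, up to a finite carry set `S`, with `a`
digits: `φ^k(F) φ(S) ⊆ S C` with `|C| ≤ a`. -/
def HasCarry (a : ℕ) : Prop :=
  ∀ E : Set G, E.Finite → ∃ (k : ℕ) (S C : Set G), S.Finite ∧ 1 ∈ S ∧ C.Finite ∧ C.ncard ≤ a ∧
    (φ^[k] '' E) * (φ '' S) ⊆ S * C

theorem image_iterate_mul (n : ℕ) (s t : Set G) :
    φ^[n] '' (s * t) = (φ^[n] '' s) * (φ^[n] '' t) := by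
  rw [← Set.image2_mul, Set.image_image2_distrib (iterate_map_mul φ n), Set.image2_mul]

/-- The carry moves left through the product, leaving one digit set per factor: `D = C φ(C) ⋯
φ^{n-1}(C)`. -/
theorem exists_image_trajectory_mul_subset {k a : ℕ} {S C : Set G} (hC : C.Finite)
    (hCa : C.ncard ≤ a) (h : (φ^[k] '' F) * (φ '' S) ⊆ S * C) (n : ℕ) :
    ∃ D : Set G, D.Finite ∧ D.ncard ≤ a ^ n ∧
      (φ^[k] '' trajectory φ F n) * (φ^[n] '' S) ⊆ S * D := by
  induction n with
  | zero => exact ⟨1, Set.finite_one, (Set.ncard_singleton (1 : G)).le, by simp [trajectory]⟩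
  | succ n ih =>
    obtain ⟨D, hD, hDn, hsub⟩ := ih
    refine ⟨D * (φ^[n] '' C), hD.mul (hC.image _), ncard_mul_le.trans ?_, ?_⟩
    · rw [pow_succ]
      exact Nat.mul_le_mul hDn ((Set.ncard_image_le hC).trans hCa)
    · have e : (φ^[k] '' (φ^[n] '' (F : Set G))) * (φ^[n + 1] '' S)
          = φ^[n] '' ((φ^[k] '' F) * (φ '' S)) := by
        rw [image_iterate_mul, ← Set.image_comp, ← Set.image_comp, ← Set.image_comp,
          ← Function.iterate_add, ← Function.iterate_add, add_comm, ← Function.iterate_succ]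
      rw [trajectory, image_iterate_mul, mul_assoc, e]
      calc _ ⊆ (φ^[k] '' trajectory φ F n) * (φ^[n] '' (S * C)) :=
            Set.mul_subset_mul_left (Set.image_mono h)
        _ = (φ^[k] '' trajectory φ F n) * (φ^[n] '' S) * (φ^[n] '' C) := by
            rw [image_iterate_mul, mul_assoc]
        _ ⊆ S * D * (φ^[n] '' C) := Set.mul_subset_mul_right hsub
        _ = _ := mul_assoc _ _ _

theorem HasCarry.entropyOn_le {a : ℕ} (ha : 0 < a) (h : HasCarry φ a)
    (hF : (F : Set G).Finite) : entropyOn φ F ≤ Real.log a := by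
  obtain ⟨k, S, C, hS, h1, hC, hCa, hsub⟩ := h F hF
  have hS0 : 0 < S.ncard := (Set.ncard_pos hS).2 ⟨1, h1⟩
  have hk := trajectory_ncard_pos φ F hF k
  refine entropyOn_le_log φ F hF ha (M := (trajectory φ F k).ncard * S.ncard)
    (by positivity) ?_
  filter_upwards [eventually_ge_atTop k] with m hm
  obtain ⟨n, rfl⟩ := Nat.exists_eq_add_of_le hm
  obtain ⟨D, hD, hDn, hsub⟩ := exists_image_trajectory_mul_subset φ F hC hCa hsub n
  have h2 : (φ^[k] '' trajectory φ F n).ncard ≤ S.ncard * a ^ n := by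
    refine (Set.ncard_le_ncard ?_ (hS.mul hD)).trans
      (ncard_mul_le.trans (Nat.mul_le_mul_left _ hDn))
    refine subset_trans (fun x hx => ?_) hsub
    exact ⟨x, hx, 1, ⟨1, h1, iterate_map_one φ n⟩, mul_one x⟩
  have h3 : (trajectory φ F (k + n)).ncard ≤ (trajectory φ F k).ncard * S.ncard * a ^ (k + n) := by
    rw [trajectory_add, mul_assoc]
    refine ncard_mul_le.trans (Nat.mul_le_mul_left _ (h2.trans (Nat.mul_le_mul_left _ ?_)))
    exact Nat.pow_le_pow_right ha (Nat.le_add_left n k)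
  exact_mod_cast h3

end Growth

/-! ### Abelian groups: eventually constant growth ratio -/

section Abelian

variable {A : Type*} [CommGroup A] (φ : A →* A) (F : Subgroup A)

/-- The iterate `φ^n` as a homomorphism. -/
def iterateHom (n : ℕ) : A →* A where
  toFun := φ^[n]
  map_one' := iterate_map_one φ n
  map_mul' := iterate_map_mul φ n

/-- In an abelian group the trajectories are subgroups. -/
def trajectorySubgroup : ℕ → Subgroup A
  | 0 => ⊥
  | n + 1 => trajectorySubgroup n ⊔ F.map (iterateHom φ n)

theorem coe_trajectorySubgroup (n : ℕ) :
    (trajectorySubgroup φ F n : Set A) = trajectory φ F n := by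
  induction n with
  | zero => rfl
  | succ n ih =>
    rw [trajectorySubgroup, Subgroup.mul_normal, ih, trajectory]
    rfl

theorem mem_trajectorySubgroup {n : ℕ} {x : A} :
    x ∈ trajectorySubgroup φ F n ↔ x ∈ trajectory φ F n := by
  rw [← coe_trajectorySubgroup]; rfl

theorem map_mem_trajectorySubgroup {n : ℕ} {x : A} (hx : x ∈ trajectorySubgroup φ F n) :
    φ x ∈ trajectorySubgroup φ F (n + 1) := by
  rw [mem_trajectorySubgroup] at hx ⊢
  rw [add_comm, trajectory_add]
  exact ⟨1, one_mem_trajectory φ F 1, φ x, ⟨x, hx, rfl⟩, one_mul _⟩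

/-- The elements of `F` whose image under `φ^n` lies in the `n`-th trajectory. -/
def redundant (n : ℕ) : Subgroup F :=
  (trajectorySubgroup φ F n).comap ((iterateHom φ n).comp F.subtype)

theorem mem_redundant {n : ℕ} {f : F} :
    f ∈ redundant φ F n ↔ φ^[n] f ∈ trajectorySubgroup φ F n := Iff.rfl

theorem redundant_monotone : Monotone (redundant φ F) := by
  refine monotone_nat_of_le_succ fun n f hf => ?_
  rw [mem_redundant] at hf ⊢
  rw [Function.iterate_succ_apply']
  exact map_mem_trajectorySubgroup φ F hf

theorem exists_carry_and_log_le_entropyOn (hF : (F : Set A).Finite) :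
    ∃ (k : ℕ) (S C : Set A), S.Finite ∧ 1 ∈ S ∧ C.Finite ∧ 0 < C.ncard ∧
      (φ^[k] '' F) * (φ '' S) ⊆ S * C ∧ Real.log C.ncard ≤ entropyOn φ F := by
  have : Finite F := hF
  -- From `k` on, one transversal `C₀` of the stable subgroup serves as digit set for every `n`.
  obtain ⟨k, hk⟩ := WellFoundedGT.monotone_chain_condition ⟨redundant φ F, redundant_monotone φ F⟩
  replace hk : ∀ m, k ≤ m → redundant φ F k = redundant φ F m := hk
  let C₀ : Set A := Set.range fun q : F ⧸ redundant φ F k => ((Quotient.out q : F) : A)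
  have hC₀ : C₀.Finite := Set.finite_range _
  have hC₀F : ∀ c ∈ C₀, c ∈ F := by rintro _ ⟨q, rfl⟩; exact (Quotient.out q).2
  have hdec : ∀ f ∈ F, ∃ c ∈ C₀, φ^[k] (c⁻¹ * f) ∈ trajectorySubgroup φ F k := by
    intro f hf
    refine ⟨_, ⟨((⟨f, hf⟩ : F) : F ⧸ redundant φ F k), rfl⟩, ?_⟩
    exact QuotientGroup.eq.1 (QuotientGroup.out_eq' ((⟨f, hf⟩ : F) : F ⧸ redundant φ F k))
  have hsep : ∀ n, k ≤ n → ∀ c ∈ C₀, ∀ c' ∈ C₀,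
      φ^[n] (c⁻¹ * c') ∈ trajectorySubgroup φ F n → c = c' := by
    rintro n hn _ ⟨q, rfl⟩ _ ⟨q', rfl⟩ h
    have h' : (Quotient.out q)⁻¹ * Quotient.out q' ∈ redundant φ F k :=
      (hk n hn).ge h
    have := QuotientGroup.eq.2 h'
    rw [QuotientGroup.out_eq', QuotientGroup.out_eq'] at this
    rw [this]
  have hinj : Set.InjOn φ^[k] C₀ := by
    intro c hc c' hc' h
    refine hsep k le_rfl c hc c' hc' ?_
    rw [iterate_map_mul, iterate_map_inv, h, inv_mul_cancel]
    exact one_mem _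
  have hpos : 0 < C₀.ncard := (Set.ncard_pos hC₀).2 (Set.range_nonempty _)
  have hcard : (φ^[k] '' C₀).ncard = C₀.ncard := hinj.ncard_image
  refine ⟨k, trajectory φ F k, φ^[k] '' C₀, trajectory_finite φ F hF k,
    one_mem_trajectory φ F k, hC₀.image _, by rwa [hcard], ?_, ?_⟩
  · rintro _ ⟨_, ⟨f, hf, rfl⟩, _, ⟨s, hs, rfl⟩, rfl⟩
    have hs' : φ s ∈ trajectory φ F (k + 1) := by
      rw [← mem_trajectorySubgroup] at hs ⊢
      exact map_mem_trajectorySubgroup φ F hs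
    -- Since `φ s = t * φ^k(g)`, the product is `t * φ^k(f * g)`; replacing `f * g` by its
    -- representative costs only an element of `T_k`.
    obtain ⟨t, ht, _, ⟨g, hg, rfl⟩, hts⟩ := hs'
    obtain ⟨c, hc, hcf⟩ := hdec (f * g) (F.mul_mem hf hg)
    refine ⟨t * φ^[k] (c⁻¹ * (f * g)), ?_, φ^[k] c, ⟨c, hc, rfl⟩, ?_⟩
    · rw [← mem_trajectorySubgroup] at ht ⊢
      exact mul_mem ht hcf
    · simp only [iterate_map_mul, iterate_map_inv, ← hts]
      rw [mul_comm (φ^[k] c)⁻¹, ← mul_assoc, inv_mul_cancel_right, mul_left_comm]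
  · rw [hcard]
    have hstep : ∀ n, C₀.ncard ^ n ≤ (trajectory φ F (k + n)).ncard := by
      intro n
      induction n with
      | zero => exact trajectory_ncard_pos φ F hF k
      | succ n ih =>
        rw [pow_succ]
        refine (Nat.mul_le_mul_right _ ih).trans ?_
        rw [← Set.ncard_prod]
        refine Set.ncard_le_ncard_of_injOn (fun p => p.1 * φ^[k + n] p.2) ?_ ?_
          (trajectory_finite φ F hF _)
        · rintro ⟨t, c⟩ ⟨ht, hc⟩
          exact ⟨t, ht, _, ⟨c, hC₀F c hc, rfl⟩, rfl⟩
        · rintro ⟨t, c⟩ ⟨ht, hc⟩ ⟨t', c'⟩ ⟨ht', hc'⟩ h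
          dsimp only at h ht ht' hc hc'
          rw [← mem_trajectorySubgroup] at ht ht'
          have hcc : c = c' := by
            refine hsep (k + n) (Nat.le_add_right k n) c hc c' hc' ?_
            rw [iterate_map_mul, iterate_map_inv]
            have : (φ^[k + n] c)⁻¹ * φ^[k + n] c' = t * t'⁻¹ := by
              rw [inv_mul_eq_iff_eq_mul, ← mul_assoc, eq_mul_inv_iff_mul_eq, mul_comm _ t', ← h,
                mul_comm]
            rw [this]
            exact mul_mem ht (inv_mem ht')
          subst hcc
          rw [mul_right_cancel h]
    have hc : (0 : ℝ) < C₀.ncard := by exact_mod_cast hpos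
    -- Growth by the factor `|C₀|` is known only from index `k` on, so `M` discards the first `k`
    -- factors.
    refine log_le_entropyOn φ F hF hpos (M := ((C₀.ncard : ℝ) ^ k)⁻¹) (by positivity) ?_
    filter_upwards [eventually_ge_atTop k] with m hm
    obtain ⟨n, rfl⟩ := Nat.exists_eq_add_of_le hm
    rw [pow_add, inv_mul_cancel_left₀ (by positivity)]
    exact_mod_cast hstep n

end Abelian

/-- The entropies `H(φ, F)` have maximum `log a`, and `φ` admits carries with `a` digits. -/
def HasExactCarry {G : Type*} [Group G] (φ : G →* G) (a : ℕ) : Prop :=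
  0 < a ∧ HasCarry φ a ∧ ∃ F : Subgroup G, (F : Set G).Finite ∧ Real.log a ≤ entropyOn φ F

theorem HasExactCarry.entropy_eq {G : Type*} [Group G] {φ : G →* G} {a : ℕ}
    (h : HasExactCarry φ a) : entropy φ = ((Real.log (a : ℝ) : ℝ) : EReal) := by
  obtain ⟨ha, hc, F, hF, hle⟩ := h
  refine le_antisymm (iSup_le fun F => EReal.coe_le_coe_iff.2 (hc.entropyOn_le φ F.1 ha F.2)) ?_
  exact (EReal.coe_le_coe_iff.2 hle).trans (le_iSup (fun F :
    {F : Subgroup G // (F : Set G).Finite} => (entropyOn φ F.1 : EReal)) ⟨F, hF⟩)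

/-! ### Torsion nilpotent groups are locally finite -/

section LocallyFinite

theorem _root_.Group.finite_of_fg_of_isMulTorsion_of_isNilpotent (G : Type*) [Group G]
    [Group.IsNilpotent G] (hfg : Group.FG G) (hT : IsMulTorsion G) : Finite G := by
  revert hfg hT
  refine Group.nilpotent_center_quotient_ind
    (P := fun G _ _ => Group.FG G → IsMulTorsion G → Finite G) G ?_ ?_
  · intro G _ _ _ _
    infer_instance
  · intro G _ _ ih _ hT
    have : Finite (G ⧸ Subgroup.center G) :=
      ih inferInstance (hT.of_surjective (QuotientGroup.mk'_surjective _))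
    have : (Subgroup.center G).FiniteIndex := Subgroup.finiteIndex_of_finite_quotient
    have : Group.FG (Subgroup.center G) := inferInstance
    let _ : CommGroup (Subgroup.center G) :=
      { (inferInstance : Group (Subgroup.center G)) with
        mul_comm := fun x y => Subtype.ext (Subgroup.mem_center_iff.1 y.2 x) }
    have : Finite (Subgroup.center G) := CommGroup.finite_of_fg_isMulTorsion _ (hT.subgroup _)
    exact Finite.of_subgroup_quotient (Subgroup.center G)

theorem _root_.Subgroup.finite_closure_of_isMulTorsion_of_isNilpotent {G : Type*} [Group G]
    [Group.IsNilpotent G] (hT : IsMulTorsion G) {s : Set G} (hs : s.Finite) :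
    (Subgroup.closure s : Set G).Finite := by
  have : Finite s := hs
  exact Group.finite_of_fg_of_isMulTorsion_of_isNilpotent (Subgroup.closure s)
    inferInstance (hT.subgroup _)

end LocallyFinite

theorem exists_hasExactCarry_of_comm {A : Type*} [CommGroup A] (hT : IsMulTorsion A) (φ : A →* A)
    {B : ℝ} (hB : ∀ F : Subgroup A, (F : Set A).Finite → entropyOn φ F ≤ B) :
    ∃ a, HasExactCarry φ a := by
  choose! k S C hS h1 hC hpos hsub hlog using exists_carry_and_log_le_entropyOn φ
  let V : Set ℕ := (fun F => (C F).ncard) '' {F : Subgroup A | (F : Set A).Finite}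
  have hne : V.Nonempty := ⟨_, ⊥, Set.finite_singleton 1, rfl⟩
  have hbdd : BddAbove V := by
    -- `log |C F| ≤ H(φ, F) ≤ B`, so a largest digit count exists.
    refine ⟨⌊Real.exp B⌋₊, ?_⟩
    rintro _ ⟨F, hF, rfl⟩
    refine Nat.le_floor ?_
    rw [← Real.log_le_iff_le_exp (by exact_mod_cast hpos F hF)]
    exact (hlog F hF).trans (hB F hF)
  obtain ⟨F, hF, hFV⟩ := Nat.sSup_mem hne hbdd
  dsimp only at hFV
  refine ⟨(C F).ncard, hpos F hF, fun E hE => ?_, F, hF, hlog F hF⟩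
  have hE' := Subgroup.finite_closure_of_isMulTorsion_of_isNilpotent hT hE
  refine ⟨k (Subgroup.closure E), S _, C _, hS _ hE', h1 _ hE', hC _ hE', ?_,
    LE.le.trans ?_ (hsub _ hE')⟩
  · rw [hFV]
    exact le_csSup hbdd ⟨_, hE', rfl⟩
  · exact Set.mul_subset_mul_right (Set.image_mono Subgroup.subset_closure)

/-! ### Central extensions -/

section Extension

variable {A G Q : Type*} [Group A] [Group G] [Group Q] {ι : A →* G} {π : G →* Q}
  {α : A →* A} {φ : G →* G} {ψ : Q →* Q}

/-- The lift `y` must not depend on `z`, so that `(z, x) ↦ ι z * y` is injective. Centrality lets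
each factor of `z` merge with the matching factor of `y` inside `F`. -/
theorem exists_lift_mul_mem_trajectory (hα : ∀ x, φ (ι x) = ι (α x)) (hψ : ∀ x, π (φ x) = ψ (π x))
    (hcen : ∀ x g, ι x * g = g * ι x) {F₁ : Subgroup A} {F₂ : Subgroup Q} {F : Subgroup G}
    (h₁ : F₁.map ι ≤ F) (h₂ : F₂ ≤ F.map π) (n : ℕ) :
    ∀ x ∈ trajectory ψ F₂ n, ∃ y, π y = x ∧ ∀ z ∈ trajectory α F₁ n, ι z * y ∈ trajectory φ F n := by
  have hα' : ∀ n x, φ^[n] (ι x) = ι (α^[n] x) := fun n x =>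
    (Function.Semiconj.iterate_right (f := ι) (fun x => (hα x).symm) n x).symm
  have hψ' : ∀ n x, π (φ^[n] x) = ψ^[n] (π x) := fun n x =>
    Function.Semiconj.iterate_right (f := π) hψ n x
  induction n with
  | zero =>
    rintro _ rfl
    refine ⟨1, map_one π, ?_⟩
    rintro _ rfl
    rw [map_one, mul_one]
    rfl
  | succ n ih =>
    rintro _ ⟨x, hx, _, ⟨f, hf, rfl⟩, rfl⟩
    obtain ⟨y, rfl, hy⟩ := ih x hx
    obtain ⟨e, he, rfl⟩ := h₂ hf
    refine ⟨y * φ^[n] e, by rw [map_mul, hψ'], ?_⟩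
    rintro _ ⟨z, hz, _, ⟨g, hg, rfl⟩, rfl⟩
    refine ⟨ι z * y, hy z hz, φ^[n] (ι g * e), ⟨_, F.mul_mem (h₁ ⟨g, hg, rfl⟩) he, rfl⟩, ?_⟩
    simp only [map_mul, iterate_map_mul, hα']
    rw [mul_assoc, ← mul_assoc y, ← hcen, mul_assoc, mul_assoc]

theorem entropyOn_add_le (hι : Function.Injective ι) (hπι : ∀ x, π (ι x) = 1)
    (hα : ∀ x, φ (ι x) = ι (α x)) (hψ : ∀ x, π (φ x) = ψ (π x))
    (hcen : ∀ x g, ι x * g = g * ι x) {F₁ : Subgroup A} {F₂ : Subgroup Q} {F : Subgroup G}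
    (hF₁ : (F₁ : Set A).Finite) (hF₂ : (F₂ : Set Q).Finite) (hF : (F : Set G).Finite)
    (h₁ : F₁.map ι ≤ F) (h₂ : F₂ ≤ F.map π) :
    entropyOn α F₁ + entropyOn ψ F₂ ≤ entropyOn φ F := by
  refine le_of_tendsto_of_tendsto'
    ((tendsto_entropyOn α F₁ hF₁).add (tendsto_entropyOn ψ F₂ hF₂))
    (tendsto_entropyOn φ F hF) fun n => ?_
  have p₁ := trajectory_ncard_pos α F₁ hF₁ n
  have p₂ := trajectory_ncard_pos ψ F₂ hF₂ n
  have key : (trajectory α F₁ n).ncard * (trajectory ψ F₂ n).ncard ≤ (trajectory φ F n).ncard := by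
    choose! y hy hz using exists_lift_mul_mem_trajectory hα hψ hcen h₁ h₂ n
    rw [← Set.ncard_prod]
    refine Set.ncard_le_ncard_of_injOn (fun p => ι p.1 * y p.2) ?_ ?_ (trajectory_finite φ F hF n)
    · rintro ⟨z, x⟩ ⟨hz', hx⟩
      exact hz x hx z hz'
    · rintro ⟨z, x⟩ ⟨_, hx⟩ ⟨z', x'⟩ ⟨_, hx'⟩ h
      dsimp only at h hx hx'
      have hxx : x = x' := by
        have := congrArg π h
        rwa [map_mul, map_mul, hπι, hπι, one_mul, one_mul, hy x hx, hy x' hx'] at this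
      subst hxx
      rw [hι (mul_right_cancel h)]
  rw [← add_div, ← Real.log_mul (by positivity) (by positivity)]
  gcongr
  exact_mod_cast key

theorem HasCarry.extension (hι : Function.Injective ι) (hker : ∀ g, π g = 1 → ∃ x, ι x = g)
    (hπ : Function.Surjective π)
    (hα : ∀ x, φ (ι x) = ι (α x)) (hψ : ∀ x, π (φ x) = ψ (π x))
    (hcen : ∀ x g, ι x * g = g * ι x) {a b : ℕ} (ha : HasCarry α a) (hb : HasCarry ψ b) :
    HasCarry φ (a * b) := by
  have hα' : ∀ n x, φ^[n] (ι x) = ι (α^[n] x) := fun n x =>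
    (Function.Semiconj.iterate_right (f := ι) (fun x => (hα x).symm) n x).symm
  have hψ' : ∀ n x, π (φ^[n] x) = ψ^[n] (π x) := fun n x =>
    Function.Semiconj.iterate_right (f := π) hψ n x
  intro E hE
  obtain ⟨k, S, C, hS, h1, hC, hCb, hsub⟩ := hb (π '' E) (hE.image _)
  let σ := Function.surjInv hπ
  have hσ : ∀ q, π (σ q) = q := Function.surjInv_eq hπ
  let S' : Set G := insert 1 (σ '' S)
  have hS' : S'.Finite := (hS.image _).insert 1
  have hπS : ∀ s ∈ S', π s ∈ S := by
    rintro _ (rfl | ⟨s, hs, rfl⟩)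
    · rwa [map_one]
    · rwa [hσ]
  let C' : Set G := σ '' C
  have hC' : C'.Finite := hC.image _
  -- The errors made by lifting the carry relation from `Q`. They form a mere finite set, which is
  -- why `HasCarry` quantifies over sets; the carry for `α` is applied to them.
  let Z : Set A := ι ⁻¹' (C'⁻¹ * S'⁻¹ * ((φ^[k] '' E) * (φ '' S')))
  have hZ : Z.Finite :=
    ((hC'.inv.mul hS'.inv).mul ((hE.image _).mul (hS'.image _))).preimage hι.injOn
  have hlift : (φ^[k] '' E) * (φ '' S') ⊆ S' * C' * (ι '' Z) := by
    rintro _ ⟨_, ⟨e, he, rfl⟩, _, ⟨s, hs, rfl⟩, rfl⟩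
    have hm : π (φ^[k] e * φ s) ∈ S * C := by
      rw [map_mul, hψ', hψ]
      exact hsub ⟨_, ⟨_, ⟨e, he, rfl⟩, rfl⟩, _, ⟨_, hπS s hs, rfl⟩, rfl⟩
    obtain ⟨t, ht, c, hc, htc⟩ := hm
    dsimp only at htc
    obtain ⟨z, hz⟩ := hker ((σ c)⁻¹ * (σ t)⁻¹ * (φ^[k] e * φ s)) (by
      rw [map_mul _ _ (φ^[k] e * φ s), ← htc, map_mul, map_inv, map_inv, hσ, hσ]
      group)
    refine ⟨σ t * σ c, ⟨_, Or.inr ⟨t, ht, rfl⟩, _, ⟨c, hc, rfl⟩, rfl⟩, ι z, ⟨z, ?_, rfl⟩, ?_⟩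
    · change ι z ∈ C'⁻¹ * S'⁻¹ * ((φ^[k] '' E) * (φ '' S'))
      rw [hz]
      exact ⟨_, ⟨_, Set.inv_mem_inv.2 ⟨c, hc, rfl⟩, _,
        Set.inv_mem_inv.2 (Or.inr ⟨t, ht, rfl⟩), rfl⟩, _,
        ⟨_, ⟨e, he, rfl⟩, _, ⟨s, hs, rfl⟩, rfl⟩, rfl⟩
    · dsimp only
      rw [hz]
      group
  obtain ⟨l, S₁, C₁, hS₁, h1', hC₁, hCa, hsub₁⟩ := ha Z hZ
  -- Applying `φ^l` to the lifted relation turns the errors into `α^l(Z)`, which the carry for `α`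
  -- absorbs.
  refine ⟨l + k, (φ^[l] '' S') * (ι '' S₁), (φ^[l] '' C') * (ι '' C₁),
    (hS'.image _).mul (hS₁.image _),
    ⟨1, ⟨1, Or.inl rfl, iterate_map_one φ l⟩, 1, ⟨1, h1', map_one ι⟩, mul_one 1⟩,
    (hC'.image _).mul (hC₁.image _), ?_, ?_⟩
  · rw [mul_comm a b]
    exact ncard_mul_le.trans (Nat.mul_le_mul
      ((Set.ncard_image_le hC').trans ((Set.ncard_image_le hC).trans hCb))
      ((Set.ncard_image_le hC₁).trans hCa))
  · rintro _ ⟨_, ⟨e, he, rfl⟩, _, ⟨_, ⟨_, ⟨s, hs, rfl⟩, _, ⟨v, hv, rfl⟩, rfl⟩, rfl⟩, rfl⟩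
    obtain ⟨_, ⟨t, ht, c, hc, rfl⟩, _, ⟨z, hz, rfl⟩, h⟩ :=
      hlift ⟨_, ⟨e, he, rfl⟩, _, ⟨s, hs, rfl⟩, rfl⟩
    obtain ⟨w, hw, d, hd, h'⟩ := hsub₁ ⟨_, ⟨z, hz, rfl⟩, _, ⟨v, hv, rfl⟩, rfl⟩
    dsimp only at h h'
    refine ⟨_, ⟨_, ⟨t, ht, rfl⟩, _, ⟨w, hw, rfl⟩, rfl⟩, _,
      ⟨_, ⟨c, hc, rfl⟩, _, ⟨d, hd, rfl⟩, rfl⟩, ?_⟩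
    dsimp only
    calc φ^[l] t * ι w * (φ^[l] c * ι d) = φ^[l] t * φ^[l] c * (ι (w * d)) := by
          rw [map_mul, mul_assoc, ← mul_assoc (ι w), hcen w]
          simp only [mul_assoc]
      _ = φ^[l] (t * c * ι z) * ι (α v) := by
          rw [h', map_mul, iterate_map_mul, iterate_map_mul, hα', mul_assoc _ _ (ι (α v))]
      _ = φ^[l + k] e * φ (φ^[l] s * ι v) := by
          rw [h, iterate_map_mul, map_mul, hα, ← Function.iterate_succ_apply' φ l s,
            Function.iterate_succ_apply, Function.iterate_add_apply, mul_assoc]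

end Extension

/-! ### Induction on the nilpotency class -/

theorem exists_hasExactCarry {G : Type*} [Group G] (hT : IsMulTorsion G) (φ : G →* G) {c : ℕ}
    (hc : (⊤ : Subgroup G).lowerCentralSeries c = ⊥) {B : ℝ}
    (hB : ∀ F : Subgroup G, (F : Set G).Finite → entropyOn φ F ≤ B) :
    ∃ a, HasExactCarry φ a := by
  induction c generalizing G with
  | zero =>
    have hs : ∀ x : G, x = 1 := fun x => by
      have : x ∈ (⊥ : Subgroup G) := hc ▸ Subgroup.mem_top x
      simpa using this
    have hbot : ((⊥ : Subgroup G) : Set G).Finite := Set.finite_singleton 1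
    refine ⟨1, one_pos, fun E _ => ⟨0, 1, 1, Set.finite_one, rfl, Set.finite_one,
      (Set.ncard_singleton (1 : G)).le, ?_⟩,
      ⊥, hbot, by simpa using entropyOn_nonneg φ ⊥ hbot⟩
    intro x _
    rw [hs x, mul_one]
    rfl
  | succ c ih =>
    have : Group.IsNilpotent G := Subgroup.nilpotent_iff_lowerCentralSeries.2 ⟨_, hc⟩
    -- This term is central because the next one is trivial, and every endomorphism preserves it.
    let N : Subgroup G := (⊤ : Subgroup G).lowerCentralSeries c
    have hcen : ∀ (x : N) (g : G), N.subtype x * g = g * N.subtype x := by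
      intro x g
      rw [Subgroup.lowerCentralSeries_succ, Subgroup.commutator_eq_bot_iff_le_centralizer] at hc
      exact (Subgroup.mem_centralizer_iff.1 (hc x.2) g (Subgroup.mem_top g)).symm
    have hinv : N ≤ N.comap φ := by
      rw [← Subgroup.map_le_iff_le_comap, Subgroup.map_lowerCentralSeries]
      exact Subgroup.lowerCentralSeries_mono c le_top
    let α : N →* N := (φ.comp N.subtype).codRestrict N fun x => hinv x.2
    let ψ : G ⧸ N →* G ⧸ N := QuotientGroup.map N N φ hinv
    let π : G →* G ⧸ N := QuotientGroup.mk' N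
    have hπ : Function.Surjective π := QuotientGroup.mk'_surjective N
    have hker : ∀ g, π g = 1 → ∃ x, N.subtype x = g := fun g hg =>
      ⟨⟨g, (QuotientGroup.eq_one_iff g).1 hg⟩, rfl⟩
    have hπι : ∀ x, π (N.subtype x) = 1 := fun x => (QuotientGroup.eq_one_iff _).2 x.2
    have hα : ∀ x, φ (N.subtype x) = N.subtype (α x) := fun _ => rfl
    have hψ : ∀ x, π (φ x) = ψ (π x) := fun _ => rfl
    have hadd : ∀ (F₁ : Subgroup N) (F₂ : Subgroup (G ⧸ N)), (F₁ : Set N).Finite →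
        (F₂ : Set (G ⧸ N)).Finite → ∃ F : Subgroup G, (F : Set G).Finite ∧
          entropyOn α F₁ + entropyOn ψ F₂ ≤ entropyOn φ F := by
      intro F₁ F₂ hF₁ hF₂
      let s : Set G := (N.subtype '' F₁) ∪ (Function.surjInv hπ '' F₂)
      have hs : s.Finite := (hF₁.image _).union (hF₂.image _)
      have hF := Subgroup.finite_closure_of_isMulTorsion_of_isNilpotent hT hs
      refine ⟨_, hF, entropyOn_add_le N.subtype_injective hπι hα hψ hcen hF₁ hF₂ hF ?_ ?_⟩
      · rintro _ ⟨x, hx, rfl⟩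
        exact Subgroup.subset_closure (Or.inl ⟨x, hx, rfl⟩)
      · intro q hq
        exact ⟨_, Subgroup.subset_closure (Or.inr ⟨q, hq, rfl⟩), Function.surjInv_eq hπ q⟩
    have hbot : ∀ (H : Type _) [Group H], ((⊥ : Subgroup H) : Set H).Finite := fun H _ =>
      Set.finite_singleton 1
    have hα_ex : ∃ a, HasExactCarry α a := by
      let _ : CommGroup N :=
        { (inferInstance : Group N) with mul_comm := fun x y => Subtype.ext (hcen x y) }
      refine exists_hasExactCarry_of_comm (hT.subgroup N) α (B := B) fun F₁ hF₁ => ?_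
      -- Pairing with the trivial subgroup passes the bound `B` down to `α`.
      obtain ⟨F, hF, hle⟩ := hadd F₁ ⊥ hF₁ (hbot _)
      linarith [entropyOn_nonneg ψ ⊥ (hbot _), hB F hF]
    have hψ_ex : ∃ b, HasExactCarry ψ b := by
      refine ih (hT.of_surjective hπ) ψ ?_ (fun F₂ hF₂ => ?_)
      · rw [← Subgroup.map_top_of_surjective π hπ, ← Subgroup.map_lowerCentralSeries,
          Subgroup.map_eq_bot_iff, QuotientGroup.ker_mk']
      · obtain ⟨F, hF, hle⟩ := hadd ⊥ F₂ (hbot _) hF₂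
        linarith [entropyOn_nonneg α ⊥ (hbot _), hB F hF]
    obtain ⟨a, ha, hac, F₁, hF₁, hle₁⟩ := hα_ex
    obtain ⟨b, hb, hbc, F₂, hF₂, hle₂⟩ := hψ_ex
    obtain ⟨F, hF, hle⟩ := hadd F₁ F₂ hF₁ hF₂
    refine ⟨a * b, Nat.mul_pos ha hb,
      hac.extension N.subtype_injective hker hπ hα hψ hcen hbc, F, hF, ?_⟩
    rw [Nat.cast_mul, Real.log_mul (by positivity) (by positivity)]
    linarith

end AlgebraicEntropy

theorem corollary4p7 {G : Type*} [Group G] (hT : IsMulTorsion G) (hN : Group.IsNilpotent G)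
    (φ : G →* G) (hφ : AlgebraicEntropy.entropy φ < ⊤) :
    ∃ α : ℕ, 0 < α ∧ AlgebraicEntropy.entropy φ = ((Real.log (α : ℝ) : ℝ) : EReal) := by
  obtain ⟨c, hc⟩ := Subgroup.nilpotent_iff_lowerCentralSeries.1 hN
  have hle : ∀ F : Subgroup G, (F : Set G).Finite →
      AlgebraicEntropy.entropyOn φ F ≤ (AlgebraicEntropy.entropy φ).toReal := by
    intro F hF
    have h : (AlgebraicEntropy.entropyOn φ F : EReal) ≤ AlgebraicEntropy.entropy φ :=
      le_iSup (fun F : {F : Subgroup G // (F : Set G).Finite} =>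
        (AlgebraicEntropy.entropyOn φ F.1 : EReal)) ⟨F, hF⟩
    simpa using EReal.toReal_le_toReal h (EReal.coe_ne_bot _) hφ.ne
  obtain ⟨a, ha⟩ := AlgebraicEntropy.exists_hasExactCarry hT φ hc hle
  exact ⟨a, ha.1, ha.entropy_eq⟩
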